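/- Let $\mathbb K$ be $\mathbb R$ or $\mathbb C$ and let $1<q<\infty$. Let $\mathcal D$ be the dyadic tree, i.e. the set of all finite sequences of $0$'s and $1$'s, ordered by extension, and let $c_{00}(\mathcal D)$ be the space of finitely supported families $f=(f_\alpha)_{\alpha\in\mathcal D}$ of scalars in $\mathbb K$. A segment is a non-empty totally ordered set $s\subset\mathcal D$ such that $\gamma\in s$ whenever $\alpha<\gamma<\beta$ with $\alpha,\beta\in s$; for a segment $s$ put $s^*(f)=\sum_{\alpha\in s}f_\alpha$. Let $JT_q$ be the completion of $c_{00}(\mathcal D)$ in the norm $$\|f\|_{JT_q}=\sup\Big\{\Big(\sum_{i=1}^k|s_i^*(f)|^q\Big)^{1/q} : k\ge 1,\ s_1,\dots,s_k \text{ pairwise disjoint segments of } \mathcal D\Big\},$$ let $(e_\alpha^*)_{\alpha\in\mathcal D}\subset (JT_q)^*$ be the functionals biorthogonal to the unit vectors $(e_\alpha)_{\alpha\in\mathcal D}$, and let $(JT_q)_*$ be the norm-closed linear span of $\{e_\alpha^*:\alpha\in\mathcal D\}$ in $(JT_q)^*$. Then $(JT_q)_*$ fails the Radon–Nikodym property,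 where a Banach space $X$ has the Radon–Nikodym property if for every finite measure space $(\Omega,\Sigma,\mu)$ and every $\mu$-continuous countably additive vector measure $G:\Sigma\to X$ of bounded variation there is a Bochner integrable $g:\Omega\to X$ with $G(E)=\int_E g\,d\mu$ for all $E\in\Sigma$. -/

import Mathlib

open MeasureTheory

universe w

/-! ### The Radon–Nikodym property -/

/-- The Radon–Nikodym property of a Banach space `X`: for every finite measure space `(Ω, μ)`, every
`X`-valued vector measure `G` on `Ω` which is of bounded variation and `μ`-continuous has a Bochner
integrable density with respect to `μ`. -/
def HasRadonNikodymProperty (X : Type*) [NormedAddCommGroup X] [NormedSpace ℝ X]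
    [CompleteSpace X] : Prop :=
  ∀ (Ω : Type w) [MeasurableSpace Ω] (μ : Measure Ω) [IsFiniteMeasure μ] (G : VectorMeasure Ω X),
    G.variation Set.univ < ⊤ →
    (∀ E : Set Ω, MeasurableSet E → μ E = 0 → G E = 0) →
    ∃ g : Ω → X, Integrable g μ ∧ ∀ E : Set Ω, MeasurableSet E → G E = ∫ x in E, g x ∂μ

namespace JamesTree

noncomputable section

/-! ### The dyadic tree and its segments -/

/-- The dyadic tree: finite sequences of `0`s and `1`s. It is ordered by extension, that is, by the
prefix relation `<+:`. -/
abbrev Node : Type := List Bool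

/-- A segment of the dyadic tree: a non-empty, totally ordered and order-convex set of nodes
(finite or infinite). -/
structure IsSegment (s : Set Node) : Prop where
  nonempty : s.Nonempty
  total : ∀ α ∈ s, ∀ β ∈ s, α <+: β ∨ β <+: α
  convex : ∀ α ∈ s, ∀ β ∈ s, ∀ γ : Node, α <+: γ → γ <+: β → γ ∈ s

/-- The functional `s^*(f) = ∑_{α ∈ s} f α` on finitely supported families of scalars indexed by the
nodes. -/
def segmentSum (𝕜 : Type*) [RCLike 𝕜] (s : Set Node) : (Node →₀ 𝕜) →ₗ[𝕜] 𝕜 :=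
  Finsupp.linearCombination 𝕜 (s.indicator fun _ => (1 : 𝕜))

/-- The numbers `(∑_{i=1}^k |s_i^*(f)|^q)^{1/q}`, for `k ≥ 1` and disjoint segments
`s_1, …, s_k`. -/
def segmentValues {𝕜 : Type*} [RCLike 𝕜] (q : ℝ) (f : Node →₀ 𝕜) : Set ℝ :=
  {r | ∃ (k : ℕ) (s : Fin k → Set Node), 1 ≤ k ∧ (∀ i, IsSegment (s i)) ∧
    (∀ i j, i ≠ j → Disjoint (s i) (s j)) ∧
    r = (∑ i, ‖segmentSum 𝕜 (s i) f‖ ^ q) ^ (1 / q)}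

section norm_facts

variable {𝕜 : Type*} [RCLike 𝕜]

theorem segmentSum_apply (s : Set Node) (f : Node →₀ 𝕜) :
    segmentSum 𝕜 s f = ∑ α ∈ f.support, s.indicator (fun β => f β) α := by
  classical
  simp only [segmentSum, Finsupp.linearCombination_apply, Finsupp.sum]
  refine Finset.sum_congr rfl fun α _ => ?_
  by_cases h : α ∈ s <;> simp [h]

theorem isSegment_singleton (α : Node) : IsSegment {α} := by
  refine ⟨⟨α, rfl⟩, ?_, ?_⟩
  · rintro _ rfl _ rfl
    exact Or.inl (List.prefix_refl _)
  · rintro _ rfl _ rfl γ h1 h2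
    exact h2.eq_of_length (le_antisymm h2.length_le h1.length_le)

theorem segmentSum_singleton (α : Node) (f : Node →₀ 𝕜) : segmentSum 𝕜 {α} f = f α := by
  classical
  rw [segmentSum_apply]
  by_cases h : α ∈ f.support
  · rw [Finset.sum_eq_single α]
    · simp
    · intro β _ hb
      simp [hb]
    · intro h'
      exact absurd h h'
  · have h0 : f α = 0 := by simpa using h
    rw [h0]
    refine Finset.sum_eq_zero fun β hb => ?_
    have : β ≠ α := by
      rintro rfl
      exact h hb
    simp [this]

theorem sum_norm_segmentSum_le (f : Node →₀ 𝕜) {k : ℕ} (s : Fin k → Set Node)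
    (hd : ∀ i j, i ≠ j → Disjoint (s i) (s j)) :
    ∑ i, ‖segmentSum 𝕜 (s i) f‖ ≤ ∑ α ∈ f.support, ‖f α‖ := by
  classical
  calc ∑ i, ‖segmentSum 𝕜 (s i) f‖
      ≤ ∑ i, ∑ α ∈ f.support, ‖(s i).indicator (fun β => f β) α‖ := by
        refine Finset.sum_le_sum fun i _ => ?_
        rw [segmentSum_apply]
        exact norm_sum_le _ _
    _ = ∑ α ∈ f.support, ∑ i, ‖(s i).indicator (fun β => f β) α‖ := Finset.sum_comm
    _ ≤ ∑ α ∈ f.support, ‖f α‖ := by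
        refine Finset.sum_le_sum fun α _ => ?_
        by_cases h : ∃ i, α ∈ s i
        · obtain ⟨i, hi⟩ := h
          rw [Finset.sum_eq_single i]
          · simp [hi]
          · intro j _ hj
            have : α ∉ s j := fun hj' => Set.disjoint_left.1 (hd j i hj) hj' hi
            simp [this]
          · simp
        · push Not at h
          simp [h]

theorem bddAbove_segmentValues {q : ℝ} (hq : 1 < q) (f : Node →₀ 𝕜) :
    BddAbove (segmentValues q f) := by
  set M := ∑ α ∈ f.support, ‖f α‖ with hM
  have hM0 : 0 ≤ M := Finset.sum_nonneg fun _ _ => norm_nonneg _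
  refine ⟨M, ?_⟩
  rintro r ⟨k, s, -, -, hd, rfl⟩
  have hsum := sum_norm_segmentSum_le f s hd
  have hle : ∀ i, ‖segmentSum 𝕜 (s i) f‖ ≤ M := fun i =>
    (Finset.single_le_sum (f := fun i => ‖segmentSum 𝕜 (s i) f‖)
      (fun _ _ => norm_nonneg _) (Finset.mem_univ i)).trans hsum
  have hpow : ∀ x : ℝ, 0 ≤ x → x ^ q = x ^ (q - 1) * x := by
    intro x hx
    have := Real.rpow_add_one' hx (y := q - 1) (by linarith)
    simpa using this
  have key : ∑ i, ‖segmentSum 𝕜 (s i) f‖ ^ q ≤ M ^ q := by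
    calc ∑ i, ‖segmentSum 𝕜 (s i) f‖ ^ q
        ≤ ∑ i, M ^ (q - 1) * ‖segmentSum 𝕜 (s i) f‖ := by
          refine Finset.sum_le_sum fun i _ => ?_
          rw [hpow _ (norm_nonneg _)]
          exact mul_le_mul_of_nonneg_right
            (Real.rpow_le_rpow (norm_nonneg _) (hle i) (by linarith)) (norm_nonneg _)
      _ = M ^ (q - 1) * ∑ i, ‖segmentSum 𝕜 (s i) f‖ := by rw [Finset.mul_sum]
      _ ≤ M ^ (q - 1) * M := mul_le_mul_of_nonneg_left hsum (Real.rpow_nonneg hM0 _)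
      _ = M ^ q := (hpow _ hM0).symm
  calc (∑ i, ‖segmentSum 𝕜 (s i) f‖ ^ q) ^ (1 / q) ≤ (M ^ q) ^ (1 / q) :=
        Real.rpow_le_rpow (Finset.sum_nonneg fun _ _ => Real.rpow_nonneg (norm_nonneg _) _) key
          (by positivity)
    _ = M := by
        rw [← Real.rpow_mul hM0, mul_one_div_cancel (by linarith), Real.rpow_one]

theorem norm_apply_mem_segmentValues {q : ℝ} (hq : 1 < q) (f : Node →₀ 𝕜) (α : Node) :
    ‖f α‖ ∈ segmentValues q f := by
  refine ⟨1, fun _ => {α}, le_rfl, fun _ => isSegment_singleton α, ?_, ?_⟩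
  · intro i j h
    exact absurd (Subsingleton.elim i j) h
  · simp only [segmentSum_singleton, Finset.univ_unique, Finset.sum_singleton]
    rw [← Real.rpow_mul (norm_nonneg _), mul_one_div_cancel (by linarith), Real.rpow_one]

theorem segmentValues_nonempty {q : ℝ} (hq : 1 < q) (f : Node →₀ 𝕜) :
    (segmentValues q f).Nonempty :=
  ⟨_, norm_apply_mem_segmentValues hq f []⟩

end norm_facts

/-! ### The space `JT_q` -/

/-- The space `c₀₀` of finitely supported families of scalars indexed by the nodes of the dyadic
tree, as a carrier for the norm of `JT_q`. -/
def C00 (𝕜 : Type*) [RCLike 𝕜] (q : ℝ) (_hq : 1 < q) : Type _ := Node →₀ 𝕜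

variable (𝕜 : Type*) [RCLike 𝕜] (q : ℝ) (hq : 1 < q)

instance : AddCommGroup (C00 𝕜 q hq) := inferInstanceAs (AddCommGroup (Node →₀ 𝕜))

instance : Module 𝕜 (C00 𝕜 q hq) := inferInstanceAs (Module 𝕜 (Node →₀ 𝕜))

/-- The norm of `JT_q` on `c₀₀`: the largest of the numbers `(∑_{i=1}^k |s_i^*(f)|^q)^{1/q}`, for
`k ≥ 1` and disjoint segments `s_1, …, s_k`. -/
instance : Norm (C00 𝕜 q hq) := ⟨fun f => sSup (segmentValues q (show Node →₀ 𝕜 from f))⟩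

theorem norm_def (f : C00 𝕜 q hq) : ‖f‖ = sSup (segmentValues q (show Node →₀ 𝕜 from f)) := rfl

theorem norm_apply_le (f : C00 𝕜 q hq) (α : Node) : ‖(show Node →₀ 𝕜 from f) α‖ ≤ ‖f‖ :=
  le_csSup (bddAbove_segmentValues hq _) (norm_apply_mem_segmentValues hq _ α)

theorem norm_smul_le_C00 (c : 𝕜) (f : C00 𝕜 q hq) : ‖c • f‖ ≤ ‖c‖ * ‖f‖ := by
  have hq0 : 0 < q := by linarith
  refine csSup_le (segmentValues_nonempty hq _) ?_
  rintro r ⟨k, s, hk, hs, hd, rfl⟩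
  have h1 : ∀ i, ‖segmentSum 𝕜 (s i) (c • (show Node →₀ 𝕜 from f))‖ ^ q
      = ‖c‖ ^ q * ‖segmentSum 𝕜 (s i) (show Node →₀ 𝕜 from f)‖ ^ q := by
    intro i
    rw [map_smul, norm_smul, Real.mul_rpow (norm_nonneg _) (norm_nonneg _)]
  have h2 : (∑ i, ‖segmentSum 𝕜 (s i) (c • (show Node →₀ 𝕜 from f))‖ ^ q) ^ (1 / q)
      = ‖c‖ * (∑ i, ‖segmentSum 𝕜 (s i) (show Node →₀ 𝕜 from f)‖ ^ q) ^ (1 / q) := by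
    rw [Finset.sum_congr rfl fun i _ => h1 i, ← Finset.mul_sum,
      Real.mul_rpow (Real.rpow_nonneg (norm_nonneg _) _)
        (Finset.sum_nonneg fun _ _ => Real.rpow_nonneg (norm_nonneg _) _),
      ← Real.rpow_mul (norm_nonneg _), mul_one_div_cancel hq0.ne', Real.rpow_one]
  refine h2.le.trans (mul_le_mul_of_nonneg_left ?_ (norm_nonneg _))
  exact le_csSup (bddAbove_segmentValues hq _) ⟨k, s, hk, hs, hd, rfl⟩

theorem normCore : NormedSpace.Core 𝕜 (C00 𝕜 q hq) where
  norm_nonneg f := (norm_nonneg _).trans (norm_apply_le 𝕜 q hq f [])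
  norm_smul c f := by
    refine le_antisymm (norm_smul_le_C00 𝕜 q hq c f) ?_
    by_cases hc : c = 0
    · rw [hc, norm_zero, zero_mul]
      exact (norm_nonneg _).trans (norm_apply_le 𝕜 q hq _ [])
    · have h := norm_smul_le_C00 𝕜 q hq c⁻¹ (c • f)
      rw [inv_smul_smul₀ hc, norm_inv] at h
      have hc' : 0 < ‖c‖ := norm_pos_iff.2 hc
      rwa [← div_eq_inv_mul, le_div_iff₀ hc', mul_comm] at h
  norm_triangle f g := by
    refine csSup_le (segmentValues_nonempty hq _) ?_
    rintro r ⟨k, s, hk, hs, hd, rfl⟩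
    refine le_trans ?_ (add_le_add
      (le_csSup (bddAbove_segmentValues hq _) ⟨k, s, hk, hs, hd, rfl⟩)
      (le_csSup (bddAbove_segmentValues hq _) ⟨k, s, hk, hs, hd, rfl⟩))
    refine le_trans ?_ (Real.Lp_add_le_of_nonneg Finset.univ hq.le
      (fun _ _ => norm_nonneg _) (fun _ _ => norm_nonneg _))
    refine Real.rpow_le_rpow (Finset.sum_nonneg fun _ _ => Real.rpow_nonneg (norm_nonneg _) _)
      (Finset.sum_le_sum fun i _ => Real.rpow_le_rpow (norm_nonneg _) ?_ (by linarith))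
      (by positivity)
    have h : segmentSum 𝕜 (s i) ((show Node →₀ 𝕜 from f) + (show Node →₀ 𝕜 from g))
        = segmentSum 𝕜 (s i) (show Node →₀ 𝕜 from f)
          + segmentSum 𝕜 (s i) (show Node →₀ 𝕜 from g) := map_add _ _ _
    exact (congrArg norm h).le.trans (norm_add_le _ _)
  norm_eq_zero_iff f := by
    constructor
    · intro h
      have : (show Node →₀ 𝕜 from f) = 0 := by
        ext α
        have := norm_apply_le 𝕜 q hq f α
        rw [h] at this
        exact norm_le_zero_iff.1 this
      exact this
    · rintro rfl
      refine le_antisymm ?_ ((norm_nonneg _).trans (norm_apply_le 𝕜 q hq _ []))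
      have := norm_smul_le_C00 𝕜 q hq 0 0
      simpa using this

instance : NormedAddCommGroup (C00 𝕜 q hq) := NormedAddCommGroup.ofCore (normCore 𝕜 q hq)

instance : NormedSpace 𝕜 (C00 𝕜 q hq) := NormedSpace.ofCore (normCore 𝕜 q hq)

/-- The James tree space `JT_q`: the completion of `c₀₀` in the norm above. -/
abbrev JT : Type _ := UniformSpace.Completion (C00 𝕜 q hq)

/-! ### The predual `(JT_q)_*` -/

/-- The unit vector `e_α`, as an element of `JT_q`. -/
def unitVector (α : Node) : JT 𝕜 q hq :=
  ((show C00 𝕜 q hq from Finsupp.single α 1 : C00 𝕜 q hq) : JT 𝕜 q hq)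

/-- The coordinate functional `f ↦ f α` on `c₀₀` with the norm of `JT_q`. -/
def coordC00 (α : Node) : StrongDual 𝕜 (C00 𝕜 q hq) :=
  LinearMap.mkContinuous (Finsupp.lapply α : (Node →₀ 𝕜) →ₗ[𝕜] 𝕜) 1
    fun f => (norm_apply_le 𝕜 q hq f α).trans_eq (one_mul _).symm

/-- The functional `e_α^*` on `JT_q` biorthogonal to the unit vectors: the continuous extension of
the coordinate functional `f ↦ f α`. -/
def coord (α : Node) : StrongDual 𝕜 (JT 𝕜 q hq) :=
  (coordC00 𝕜 q hq α).extend (UniformSpace.Completion.toComplL (𝕜 := 𝕜) (E := C00 𝕜 q hq))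

theorem coord_coe (α : Node) (f : C00 𝕜 q hq) :
    coord 𝕜 q hq α (f : JT 𝕜 q hq) = (show Node →₀ 𝕜 from f) α :=
  ContinuousLinearMap.extend_eq (coordC00 𝕜 q hq α)
    (e := UniformSpace.Completion.toComplL (𝕜 := 𝕜) (E := C00 𝕜 q hq))
    UniformSpace.Completion.denseRange_coe
    (UniformSpace.Completion.isUniformInducing_coe _) f

theorem coord_unitVector (α β : Node) :
    coord 𝕜 q hq α (unitVector 𝕜 q hq β) = if β = α then 1 else 0 :=
  (coord_coe 𝕜 q hq α _).trans Finsupp.single_apply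

/-- The predual `(JT_q)_*` of `JT_q`: the closed linear span, in the dual of `JT_q` with the operator
norm, of the biorthogonal functionals `e_α^*`. -/
abbrev Predual : Submodule 𝕜 (StrongDual 𝕜 (JT 𝕜 q hq)) :=
  (Submodule.span 𝕜 (Set.range (coord 𝕜 q hq))).topologicalClosure

end

end JamesTree

/-!
# The predual of `JT_q` fails the Radon–Nikodym property

Every infinite branch `x` of the dyadic tree defines a norm-one functional `s_x^*`, the sum of the
coordinates along `x`. It is a weak-star limit of the truncations `∑_{n < N} e^*_{branch x n}`, which
lie in the predual, but it is not in the predual itself: functionals there tend to `0` along the unit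
vectors (`JamesTree.tendsto_unitVector_of_mem_predual`), whereas `s_x^*` is `1` on every unit vector of
the branch.

Let `x` be distributed according to the fair coin-tossing measure `μ`. The `n`-th truncation increment,
integrated over a set `E`, is a combination of the `2 ^ n` coordinates of level `n` with coefficients at
most `2 ^ (-n)`. Since the norm of `JT_q` dominates the `ℓ_q`-norm of the coordinates of a level, Hölder's
inequality bounds this combination by `2 ^ (-n / q)`
(`JamesTree.norm_setIntegral_predualCoord_le`). Hence the integrals of the truncations over `E` converge in
norm, and the limits, formally `∫_E s_x^* dμ`, form a vector measure with values in the predual. It is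
dominated by `μ` because the truncations are sums over segments and thus have norm at most one.

A Bochner density with values in the predual would have to agree almost everywhere with `s_x^*` on all unit vectors, which is impossible.
-/

open Filter Topology

/-! ### Vector measures as limits of bounded martingales -/

/-- If the integrals over every measurable set of uniformly bounded functions `B N` converge, the
limits form a vector measure dominated by `μ`. Countable additivity is dominated convergence for
series: `‖∫_E B N‖ ≤ μ E` for all `N`. -/
theorem exists_vectorMeasure_of_tendsto_setIntegral {Ω X : Type*} [MeasurableSpace Ω]
    [NormedAddCommGroup X] [NormedSpace ℝ X] [CompleteSpace X] (μ : Measure Ω) [IsFiniteMeasure μ]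
    (B : ℕ → Ω → X) (hB : ∀ N, Integrable (B N) μ) (hB1 : ∀ N ω, ‖B N ω‖ ≤ 1)
    (hlim : ∀ E, MeasurableSet E → ∃ x, Tendsto (fun N => ∫ ω in E, B N ω ∂μ) atTop (𝓝 x)) :
    ∃ G : VectorMeasure Ω X, (∀ E, MeasurableSet E → ‖G E‖ₑ ≤ μ E) ∧
      ∀ E, MeasurableSet E → Tendsto (fun N => ∫ ω in E, B N ω ∂μ) atTop (𝓝 (G E)) := by
  classical
  choose! L hL using hlim
  have hbound : ∀ N E, ‖∫ ω in E, B N ω ∂μ‖ ≤ μ.real E := fun N E => by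
    simpa using norm_setIntegral_le_of_norm_le_const (measure_lt_top μ E) (fun ω _ => hB1 N ω)
  have hLbound : ∀ E, MeasurableSet E → ‖L E‖ ≤ μ.real E := fun E hE =>
    le_of_tendsto (hL E hE).norm (Eventually.of_forall fun N => hbound N E)
  have hunion : ∀ f : ℕ → Set Ω, (∀ i, MeasurableSet (f i)) →
      Pairwise (Function.onFun Disjoint f) → HasSum (fun i => L (f i)) (L (⋃ i, f i)) := by
    intro f hf hd
    have hsum : Summable fun i => μ.real (f i) := by
      have h := measure_iUnion hd hf (μ := μ)
      exact ENNReal.summable_toReal (h ▸ measure_ne_top μ _)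
    have h1 := tendsto_tsum_of_dominated_convergence hsum (fun i => hL (f i) (hf i))
      (Eventually.of_forall fun N i => hbound N (f i))
    have h2 : ∀ N, ∑' i, ∫ ω in f i, B N ω ∂μ = ∫ ω in ⋃ i, f i, B N ω ∂μ := fun N =>
      (hasSum_integral_iUnion hf hd (hB N).integrableOn).tsum_eq
    simp only [h2] at h1
    rw [tendsto_nhds_unique (hL _ (.iUnion hf)) h1]
    exact (Summable.of_norm_bounded hsum fun i => hLbound (f i) (hf i)).hasSum
  refine ⟨⟨fun E => if MeasurableSet E then L E else 0, ?_, ?_, ?_⟩, ?_, ?_⟩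
  · have := hLbound ∅ .empty
    simpa using this
  · intro E hE
    simp [hE]
  · intro f hf hd
    simpa [hf, MeasurableSet.iUnion hf] using hunion f hf hd
  · intro E hE
    have := hLbound E hE
    change ‖(if MeasurableSet E then L E else 0)‖ₑ ≤ μ E
    rw [if_pos hE, ← ofReal_norm, ← ENNReal.ofReal_toReal (measure_ne_top μ E)]
    exact ENNReal.ofReal_le_ofReal this
  · intro E hE
    simpa [hE] using hL E hE

namespace JamesTree

noncomputable section

/-! ### Branches of the tree -/

/-- The node at level `n` of the infinite branch given by the sequence `x`, that is, the initial
segment of length `n` of `x`. -/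
def branch (x : ℕ → Bool) (n : ℕ) : Node := List.ofFn fun i : Fin n => x i

theorem length_branch (x : ℕ → Bool) (n : ℕ) : (branch x n).length = n := List.length_ofFn

theorem branch_injective (x : ℕ → Bool) : Function.Injective (branch x) := fun m n h => by
  simpa [length_branch] using congrArg List.length h

theorem branch_prefix (x : ℕ → Bool) {m n : ℕ} (h : m ≤ n) : branch x m <+: branch x n := by
  rw [List.prefix_iff_eq_take]
  refine List.ext_getElem (by simp [length_branch, h]) fun i h1 h2 => ?_
  simp [branch]

/-- The nodes of a branch up to a given level form a segment; this is what bounds the martingale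
`∑_{n < N} e^*_{branch x n}` below. -/
theorem isSegment_branch (x : ℕ → Bool) {N : ℕ} (hN : 0 < N) :
    IsSegment (branch x '' Set.Iio N) := by
  refine ⟨⟨_, 0, hN, rfl⟩, ?_, ?_⟩
  · rintro _ ⟨m, -, rfl⟩ _ ⟨n, -, rfl⟩
    exact (le_total m n).imp (branch_prefix x) (branch_prefix x)
  · rintro _ - _ ⟨n, hn, rfl⟩ γ - h
    have hle : γ.length ≤ n := by simpa [length_branch] using h.length_le
    refine ⟨γ.length, lt_of_le_of_lt hle hn, ?_⟩
    have h' := List.prefix_of_prefix_length_le (branch_prefix x hle) h (by simp [length_branch])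
    exact h'.eq_of_length (by simp [length_branch])

variable (𝕜 : Type*) [RCLike 𝕜] (q : ℝ) (hq : 1 < q)

/-! ### Estimates for functionals on `JT_q` -/

/-- The defining inequality of the norm of `JT_q`, for a family of disjoint segments indexed by an
arbitrary finite type. -/
theorem sum_norm_segmentSum_rpow_le {ι : Type*} [Fintype ι] (f : C00 𝕜 q hq) (s : ι → Set Node)
    (hs : ∀ i, IsSegment (s i)) (hd : Pairwise (Function.onFun Disjoint s)) :
    ∑ i, ‖segmentSum 𝕜 (s i) (show Node →₀ 𝕜 from f)‖ ^ q ≤ ‖f‖ ^ q := by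
  have hq0 : 0 < q := by linarith
  rcases isEmpty_or_nonempty ι with h | h
  · simpa using Real.rpow_nonneg (norm_nonneg f) q
  let e := Fintype.equivFin ι
  have hmem : (∑ i, ‖segmentSum 𝕜 (s i) (show Node →₀ 𝕜 from f)‖ ^ q) ^ (1 / q) ∈
      segmentValues q (show Node →₀ 𝕜 from f) := by
    refine ⟨Fintype.card ι, s ∘ e.symm, Fintype.card_pos, fun i => hs _,
      fun i j hij => hd (e.symm.injective.ne hij), ?_⟩
    rw [← e.symm.sum_comp]
    rfl
  have h1 := Real.rpow_le_rpow (Real.rpow_nonneg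
    (Finset.sum_nonneg fun i _ => Real.rpow_nonneg (norm_nonneg _) _) _)
    (le_csSup (bddAbove_segmentValues hq _) hmem) hq0.le
  rwa [← Real.rpow_mul (Finset.sum_nonneg fun i _ => Real.rpow_nonneg (norm_nonneg _) _),
    one_div_mul_cancel hq0.ne', Real.rpow_one] at h1

variable {𝕜 q hq}

theorem norm_le_of_forall_C00 (φ : StrongDual 𝕜 (JT 𝕜 q hq)) {c : ℝ} (hc : 0 ≤ c)
    (h : ∀ f : C00 𝕜 q hq, ‖φ (f : JT 𝕜 q hq)‖ ≤ c * ‖f‖) : ‖φ‖ ≤ c := by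
  refine φ.opNorm_le_bound hc fun x => ?_
  induction x using UniformSpace.Completion.induction_on with
  | hp => exact isClosed_le (by fun_prop) (by fun_prop)
  | ih f => simpa using h f

variable (𝕜 q hq)

theorem norm_sum_coord_branch_le (x : ℕ → Bool) (N : ℕ) :
    ‖∑ n ∈ Finset.range N, coord 𝕜 q hq (branch x n)‖ ≤ 1 := by
  rcases N.eq_zero_or_pos with rfl | hN
  · simp
  have hq0 : 0 < q := by linarith
  refine norm_le_of_forall_C00 _ zero_le_one fun f => ?_
  have h1 : (∑ n ∈ Finset.range N, coord 𝕜 q hq (branch x n)) (f : JT 𝕜 q hq) =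
      segmentSum 𝕜 (branch x '' Set.Iio N) (show Node →₀ 𝕜 from f) := by
    classical
    rw [_root_.sum_apply, segmentSum_apply]
    simp only [coord_coe]
    rw [← Finset.sum_image (f := fun α => (show Node →₀ 𝕜 from f) α)
      (fun m _ n _ h => branch_injective x h)]
    simp only [Set.indicator_apply, ← Finset.sum_filter]
    refine (Finset.sum_subset (fun α hα => ?_) fun α hα hα' => ?_).symm
    · simpa using (Finset.mem_filter.1 hα).2
    · by_contra h0
      exact hα' (Finset.mem_filter.2 ⟨Finsupp.mem_support_iff.2 h0, by simpa using hα⟩)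
  have h2 := sum_norm_segmentSum_rpow_le 𝕜 q hq f (fun _ : Unit => branch x '' Set.Iio N)
    (fun _ => isSegment_branch x hN) (fun i j h => (h rfl).elim)
  rw [h1, one_mul]
  simpa [Real.rpow_le_rpow_iff, hq0] using h2

/-- The average over level `n` of the moduli of the coordinates is at most `2^{-n/q} ‖f‖`: the nodes
of a level are disjoint one-point segments, so their coordinates have `ℓ_q`-norm at most `‖f‖`, and
Hölder's inequality applies. -/
theorem sum_norm_level_le (n : ℕ) (f : C00 𝕜 q hq) :
    ∑ a : Fin n → Bool, (1 / 2 : ℝ) ^ n * ‖(show Node →₀ 𝕜 from f) (List.ofFn a)‖ ≤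
      ((1 / 2 : ℝ) ^ (1 / q)) ^ n * ‖f‖ := by
  have hq0 : 0 < q := by linarith
  set S := ∑ a : Fin n → Bool, ‖(show Node →₀ 𝕜 from f) (List.ofFn a)‖ with hS
  have hS0 : 0 ≤ S := Finset.sum_nonneg fun _ _ => norm_nonneg _
  have h1 : ∑ a : Fin n → Bool, ‖(show Node →₀ 𝕜 from f) (List.ofFn a)‖ ^ q ≤ ‖f‖ ^ q := by
    have h := sum_norm_segmentSum_rpow_le 𝕜 q hq f (fun a : Fin n → Bool => {List.ofFn a})
      (fun a => isSegment_singleton _)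
      (fun a b hab => Set.disjoint_singleton.2 (List.ofFn_injective.ne hab))
    exact (Finset.sum_congr rfl fun a _ => by rw [segmentSum_singleton]).trans_le h
  have h2 : S ^ q ≤ ((2 : ℝ) ^ n) ^ (q - 1) * ‖f‖ ^ q := by
    refine (Real.rpow_sum_le_const_mul_sum_rpow_of_nonneg Finset.univ hq.le
      fun _ _ => norm_nonneg _).trans ?_
    have hcard : ((Finset.univ : Finset (Fin n → Bool)).card : ℝ) = 2 ^ n := by simp
    rw [hcard]
    gcongr
  rw [← Finset.mul_sum, ← Real.rpow_le_rpow_iff (by positivity) (by positivity) hq0,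
    Real.mul_rpow (by positivity) hS0, Real.mul_rpow (by positivity) (norm_nonneg _)]
  calc ((1 / 2 : ℝ) ^ n) ^ q * S ^ q
      ≤ ((1 / 2 : ℝ) ^ n) ^ q * (((2 : ℝ) ^ n) ^ (q - 1) * ‖f‖ ^ q) := by gcongr
    _ = (((1 / 2 : ℝ) ^ (1 / q)) ^ n) ^ q * ‖f‖ ^ q := by
        rw [← mul_assoc]
        congr 1
        have h3 : (((1 / 2 : ℝ) ^ (1 / q)) ^ n) ^ q = (1 / 2 : ℝ) ^ n := by
          rw [← Real.rpow_natCast, ← Real.rpow_mul (by positivity), ← Real.rpow_mul (by positivity),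
            ← Real.rpow_natCast]
          congr 1
          field_simp
        rw [h3, Real.rpow_sub_one (by positivity), one_div_pow, Real.div_rpow (by positivity)
          (by positivity), Real.one_rpow]
        have : ((2 : ℝ) ^ n) ^ q ≠ 0 := by positivity
        field_simp

/-! ### The predual -/

theorem norm_unitVector_le (α : Node) : ‖unitVector 𝕜 q hq α‖ ≤ 1 := by
  have hq0 : 0 < q := by linarith
  rw [unitVector, UniformSpace.Completion.norm_coe, norm_def]
  refine csSup_le (segmentValues_nonempty hq _) ?_
  rintro _ ⟨k, s, -, -, hd, rfl⟩
  have hle : ∀ i, ‖segmentSum 𝕜 (s i) (Finsupp.single α 1)‖ ≤ 1 := fun i => by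
    by_cases h : α ∈ s i <;> simp [segmentSum, h]
  refine Real.rpow_le_one (Finset.sum_nonneg fun i _ => Real.rpow_nonneg (norm_nonneg _) _) ?_
    (by positivity)
  calc ∑ i, ‖segmentSum 𝕜 (s i) (Finsupp.single α 1)‖ ^ q
      ≤ ∑ i, ‖segmentSum 𝕜 (s i) (Finsupp.single α 1)‖ :=
        Finset.sum_le_sum fun i _ => Real.rpow_le_self_of_le_one (norm_nonneg _) (hle i) hq.le
    _ ≤ ∑ β ∈ (Finsupp.single α (1 : 𝕜)).support, ‖Finsupp.single α (1 : 𝕜) β‖ :=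
        sum_norm_segmentSum_le _ s hd
    _ = 1 := by simp [Finsupp.support_single]

/-- The functionals in the predual are `c₀` along the tree: this holds with finite support on the
span of the `e_α^*`, and passes to the closure because the unit vectors are bounded. -/
theorem tendsto_unitVector_of_mem_predual {φ : StrongDual 𝕜 (JT 𝕜 q hq)}
    (hφ : φ ∈ Predual 𝕜 q hq) :
    Tendsto (fun α => φ (unitVector 𝕜 q hq α)) cofinite (𝓝 0) := by
  have hspan : ∀ ψ ∈ Submodule.span 𝕜 (Set.range (coord 𝕜 q hq)),
      Tendsto (fun α => ψ (unitVector 𝕜 q hq α)) cofinite (𝓝 0) := by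
    intro ψ hψ
    induction hψ using Submodule.span_induction with
    | mem ψ h =>
      obtain ⟨β, rfl⟩ := h
      refine tendsto_const_nhds.congr' ?_
      filter_upwards [(Set.finite_singleton β).compl_mem_cofinite] with α hα
      rw [coord_unitVector, if_neg (by simpa using hα)]
    | zero => simp
    | add ψ χ _ _ h1 h2 => simpa using h1.add h2
    | smul c ψ _ h => simpa using h.const_smul c
  rw [Metric.tendsto_nhds]
  intro ε hε
  obtain ⟨ψ, hψ, hd⟩ := Metric.mem_closure_iff.1 hφ (ε / 2) (half_pos hε)
  filter_upwards [Metric.tendsto_nhds.1 (hspan ψ hψ) (ε / 2) (half_pos hε)] with α hα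
  have h1 : ‖(φ - ψ) (unitVector 𝕜 q hq α)‖ ≤ ‖φ - ψ‖ :=
    ((φ - ψ).le_opNorm _).trans
      (mul_le_of_le_one_right (norm_nonneg _) (norm_unitVector_le 𝕜 q hq α))
  rw [dist_eq_norm] at hd
  rw [dist_zero_right] at hα ⊢
  calc ‖φ (unitVector 𝕜 q hq α)‖
      = ‖(φ - ψ) (unitVector 𝕜 q hq α) + ψ (unitVector 𝕜 q hq α)‖ := by simp
    _ ≤ ‖(φ - ψ) (unitVector 𝕜 q hq α)‖ + ‖ψ (unitVector 𝕜 q hq α)‖ := norm_add_le _ _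
    _ < ε := by linarith

/-- The predual as a normed space in its own right. On the subtype `Predual 𝕜 q hq`, instance search
finds the subspace topology of the dual, which agrees with the norm topology only after unfolding;
this synonym carries the norm topology alone, as Bochner integration needs. -/
def PredualSpace : Type _ := Predual 𝕜 q hq

instance : NormedAddCommGroup (PredualSpace 𝕜 q hq) :=
  inferInstanceAs (NormedAddCommGroup (Predual 𝕜 q hq))

instance : NormedSpace ℝ (PredualSpace 𝕜 q hq) :=
  inferInstanceAs (NormedSpace ℝ (Predual 𝕜 q hq))

instance : CompleteSpace (PredualSpace 𝕜 q hq) :=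
  inferInstanceAs (CompleteSpace (Predual 𝕜 q hq))

/-- The biorthogonal functional `e_α^*` as an element of the predual. -/
def predualCoord (α : Node) : PredualSpace 𝕜 q hq :=
  ⟨coord 𝕜 q hq α, Submodule.le_topologicalClosure _ (Submodule.subset_span ⟨α, rfl⟩)⟩

/-- Evaluation of the functionals in the predual at a point of `JT_q`, as a real linear map. -/
def predualEval (v : JT 𝕜 q hq) : PredualSpace 𝕜 q hq →L[ℝ] 𝕜 :=
  LinearMap.mkContinuous
    { toFun := fun φ => φ.1 v
      map_add' := fun _ _ => rfl
      map_smul' := fun _ _ => rfl }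
    ‖v‖ fun φ => (φ.1.le_opNorm v).trans_eq (mul_comm _ _)

theorem norm_predualSpace_le {φ : PredualSpace 𝕜 q hq} {c : ℝ} (hc : 0 ≤ c)
    (h : ∀ f : C00 𝕜 q hq, ‖predualEval 𝕜 q hq f φ‖ ≤ c * ‖f‖) : ‖φ‖ ≤ c :=
  norm_le_of_forall_C00 φ.1 hc h

theorem predualEval_predualCoord (v : JT 𝕜 q hq) (α : Node) :
    predualEval 𝕜 q hq v (predualCoord 𝕜 q hq α) = coord 𝕜 q hq α v := rfl

/-! ### The measure on the branches -/

section

variable {Ω : Type*} [MeasurableSpace Ω]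

theorem integrable_comp_branch {Y : Type*} [NormedAddCommGroup Y] (μ : Measure Ω)
    [IsFiniteMeasure μ] {x : Ω → ℕ → Bool} (hx : Measurable x) (n : ℕ) (F : Node → Y) :
    Integrable (fun ω => F (branch (x ω) n)) μ :=
  Integrable.comp_measurable (f := fun ω (i : Fin n) => x ω i)
    (g := fun a : Fin n → Bool => F (List.ofFn a)) .of_finite (by fun_prop)

/-- If the bits of `x` are independent and fair, the node of `x` at level `n` is uniformly distributed
among the `2 ^ n` nodes of that level. -/
theorem integral_comp_branch (μ : Measure Ω) [IsFiniteMeasure μ] {x : Ω → ℕ → Bool}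
    (hx : Measurable x)
    (hunif : ∀ n (a : Fin n → Bool), μ.real {ω | ∀ i : Fin n, x ω i = a i} = (1 / 2) ^ n)
    (n : ℕ) (F : Node → ℝ) :
    ∫ ω, F (branch (x ω) n) ∂μ = ∑ a : Fin n → Bool, (1 / 2) ^ n * F (List.ofFn a) := by
  have hm : Measurable fun ω (i : Fin n) => x ω i := by fun_prop
  calc ∫ ω, F (branch (x ω) n) ∂μ
      = ∫ a, F (List.ofFn a) ∂(μ.map fun ω (i : Fin n) => x ω i) :=
        (integral_map hm.aemeasurable (f := fun a : Fin n → Bool => F (List.ofFn a))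
          StronglyMeasurable.of_discrete.aestronglyMeasurable).symm
    _ = ∑ a : Fin n → Bool, (1 / 2) ^ n * F (List.ofFn a) := by
        rw [integral_fintype .of_finite]
        refine Finset.sum_congr rfl fun a _ => ?_
        rw [map_measureReal_apply hm (measurableSet_singleton a), smul_eq_mul, ← hunif n a]
        congr 2
        ext ω
        simp [funext_iff]

/-- The increments of the martingale, integrated over any set, are geometrically small, although
they have norm one pointwise. -/
theorem norm_setIntegral_predualCoord_le (μ : Measure Ω) [IsFiniteMeasure μ] {x : Ω → ℕ → Bool}
    (hx : Measurable x)
    (hunif : ∀ n (a : Fin n → Bool), μ.real {ω | ∀ i : Fin n, x ω i = a i} = (1 / 2) ^ n)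
    (n : ℕ) (E : Set Ω) :
    ‖∫ ω in E, predualCoord 𝕜 q hq (branch (x ω) n) ∂μ‖ ≤ ((1 / 2 : ℝ) ^ (1 / q)) ^ n := by
  refine norm_predualSpace_le 𝕜 q hq (by positivity) fun f => ?_
  rw [← ContinuousLinearMap.integral_comp_comm _
    (integrable_comp_branch μ hx n _).integrableOn]
  calc ‖∫ ω in E, predualEval 𝕜 q hq f (predualCoord 𝕜 q hq (branch (x ω) n)) ∂μ‖
      ≤ ∫ ω in E, ‖predualEval 𝕜 q hq f (predualCoord 𝕜 q hq (branch (x ω) n))‖ ∂μ :=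
        norm_integral_le_integral_norm _
    _ ≤ ∫ ω, ‖predualEval 𝕜 q hq f (predualCoord 𝕜 q hq (branch (x ω) n))‖ ∂μ :=
        setIntegral_le_integral (integrable_comp_branch μ hx n
          fun α => ‖predualEval 𝕜 q hq f (predualCoord 𝕜 q hq α)‖)
          (Eventually.of_forall fun _ => norm_nonneg _)
    _ = ∑ a : Fin n → Bool, (1 / 2 : ℝ) ^ n * ‖(show Node →₀ 𝕜 from f) (List.ofFn a)‖ := by
        rw [integral_comp_branch μ hx hunif n
          fun α => ‖predualEval 𝕜 q hq f (predualCoord 𝕜 q hq α)‖]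
        refine Finset.sum_congr rfl fun a _ => ?_
        rw [predualEval_predualCoord, coord_coe]
    _ ≤ _ := sum_norm_level_le 𝕜 q hq n f

/-- The vector measure `E ↦ ∫_E s_x^* dμ` of branch functionals, obtained as the limit of the
integrals of the truncated branch functionals. Its value at the unit vector `e_α` is the measure of the set of
branches in `E` through `α`. -/
theorem exists_vectorMeasure_predual (μ : Measure Ω) [IsFiniteMeasure μ] {x : Ω → ℕ → Bool}
    (hx : Measurable x)
    (hunif : ∀ n (a : Fin n → Bool), μ.real {ω | ∀ i : Fin n, x ω i = a i} = (1 / 2) ^ n) :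
    ∃ G : VectorMeasure Ω (PredualSpace 𝕜 q hq), (∀ E, MeasurableSet E → ‖G E‖ₑ ≤ μ E) ∧
      ∀ E, MeasurableSet E → ∀ α, predualEval 𝕜 q hq (unitVector 𝕜 q hq α) (G E) =
        ∫ ω in E, (if branch (x ω) α.length = α then 1 else 0) ∂μ := by
  have hint : ∀ n, Integrable (fun ω => predualCoord 𝕜 q hq (branch (x ω) n)) μ :=
    fun n => integrable_comp_branch μ hx n _
  have hsumint : ∀ E N, ∫ ω in E, ∑ n ∈ Finset.range N, predualCoord 𝕜 q hq (branch (x ω) n) ∂μ =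
      ∑ n ∈ Finset.range N, ∫ ω in E, predualCoord 𝕜 q hq (branch (x ω) n) ∂μ :=
    fun E N => integral_finsetSum _ fun n _ => (hint n).integrableOn
  obtain ⟨G, hG1, hG2⟩ := exists_vectorMeasure_of_tendsto_setIntegral μ
    (fun N ω => ∑ n ∈ Finset.range N, predualCoord 𝕜 q hq (branch (x ω) n))
    (fun N => integrable_finsetSum _ fun n _ => hint n)
    (fun N ω => by
      refine norm_predualSpace_le 𝕜 q hq zero_le_one fun f => ?_
      simp only [map_sum, predualEval_predualCoord]
      rw [← _root_.sum_apply]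
      exact (ContinuousLinearMap.le_of_opNorm_le _
        (norm_sum_coord_branch_le 𝕜 q hq (x ω) N) _).trans_eq
          (by rw [UniformSpace.Completion.norm_coe]))
    (fun E _ => by
      simp only [hsumint]
      have hr : (1 / 2 : ℝ) ^ (1 / q) < 1 :=
        Real.rpow_lt_one (by norm_num) (by norm_num) (by positivity)
      exact ⟨_, (Summable.of_norm_bounded (summable_geometric_of_lt_one (by positivity) hr)
        fun n => norm_setIntegral_predualCoord_le 𝕜 q hq μ hx hunif n E).hasSum.tendsto_sum_nat⟩)
  refine ⟨G, hG1, fun E hE α => ?_⟩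
  have h1 := ((predualEval 𝕜 q hq (unitVector 𝕜 q hq α)).continuous.tendsto _).comp (hG2 E hE)
  refine tendsto_nhds_unique h1 (tendsto_const_nhds.congr' ?_)
  filter_upwards [eventually_gt_atTop α.length] with N hN
  rw [Function.comp_apply, ← ContinuousLinearMap.integral_comp_comm _
    (integrable_finsetSum _ fun n _ => (hint n).integrableOn)]
  refine integral_congr_ae (Eventually.of_forall fun ω => ?_)
  simp only [map_sum, predualEval_predualCoord, coord_unitVector]
  rw [Finset.sum_eq_single α.length]
  · simp only [eq_comm]
  · intro n _ hn
    refine if_neg fun h => hn ?_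
    rw [h, length_branch]
  · exact fun h => absurd (Finset.mem_range.2 hN) h

end

end

end JamesTree

/-! ### Failure of the Radon–Nikodym property -/

/-- The fair coin-tossing measure on `{0, 1}^ℕ`, lifted to an arbitrary universe. -/
theorem exists_uniform_bool_sequence :
    ∃ (μ : Measure (ULift.{w} (ℕ → Bool))) (_ : IsProbabilityMeasure μ),
      ∀ n (a : Fin n → Bool), μ.real {ω | ∀ i : Fin n, ω.down i = a i} = (1 / 2) ^ n := by
  let ν : Measure Bool := (PMF.uniformOfFintype Bool).toMeasure
  have hν : ∀ b, ν {b} = 2⁻¹ := fun b => by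
    rw [PMF.toMeasure_apply_singleton _ _ (measurableSet_singleton b)]
    simp
  refine ⟨(Measure.infinitePi fun _ : ℕ => ν).map ULift.up,
    Measure.isProbabilityMeasure_map measurable_up.aemeasurable, fun n a => ?_⟩
  let t : ℕ → Set Bool := fun i => if h : i < n then {a ⟨i, h⟩} else Set.univ
  have hset : ULift.up ⁻¹' {ω : ULift.{w} (ℕ → Bool) | ∀ i : Fin n, ω.down i = a i} =
      Set.pi (Finset.range n) t := by
    ext x
    simp only [Set.mem_preimage, Set.mem_ofPred_eq, Set.mem_pi, Finset.coe_range, Set.mem_Iio, t]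
    constructor
    · intro h i hi
      simpa [hi] using h ⟨i, hi⟩
    · intro h i
      simpa using h i i.2
  have hprod : ∏ i ∈ Finset.range n, ν (t i) = (2⁻¹ : ENNReal) ^ n := by
    rw [Finset.prod_congr rfl (g := fun _ => (2⁻¹ : ENNReal)) fun i hi => ?_]
    · simp
    · simp only [t, dif_pos (Finset.mem_range.1 hi), hν]
  have hmap := MeasurableEquiv.ulift.symm.map_apply (μ := Measure.infinitePi fun _ : ℕ => ν)
    {ω : ULift.{w} (ℕ → Bool) | ∀ i : Fin n, ω.down i = a i}
  calc _ = (Measure.infinitePi (fun _ : ℕ => ν) (Set.pi (Finset.range n) t)).toReal :=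
        congrArg ENNReal.toReal (hmap.trans (congrArg _ hset))
    _ = (1 / 2) ^ n := by
      rw [Measure.infinitePi_pi _ fun i _ => .of_discrete, hprod]
      simp

theorem lemma12 (𝕜 : Type*) [RCLike 𝕜] (q : ℝ) (hq : 1 < q) :
    ¬ HasRadonNikodymProperty.{w} (JamesTree.Predual 𝕜 q hq) := by
  intro hRN
  have hRN' : HasRadonNikodymProperty.{w} (JamesTree.PredualSpace 𝕜 q hq) := hRN
  obtain ⟨μ, hμ, hunif⟩ := exists_uniform_bool_sequence.{w}
  have hx : Measurable (ULift.down : ULift.{w} (ℕ → Bool) → ℕ → Bool) := measurable_down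
  obtain ⟨G, hG1, hG2⟩ := JamesTree.exists_vectorMeasure_predual 𝕜 q hq μ hx hunif
  have hvar : G.variation Set.univ < ⊤ :=
    (VectorMeasure.variation_le_of_forall_enorm_le hG1 _).trans_lt (measure_lt_top μ _)
  obtain ⟨g, hg, hGg⟩ := hRN' _ μ G hvar fun E hE h0 => by
    simpa [h0] using hG1 E hE
  have hae : ∀ᵐ ω ∂μ, ∀ α : JamesTree.Node,
      JamesTree.predualEval 𝕜 q hq (JamesTree.unitVector 𝕜 q hq α) (g ω) =
        if JamesTree.branch ω.down α.length = α then 1 else 0 := by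
    rw [ae_all_iff]
    intro α
    refine Integrable.ae_eq_of_forall_setIntegral_eq _ _
      ((JamesTree.predualEval 𝕜 q hq (JamesTree.unitVector 𝕜 q hq α)).integrable_comp hg)
      (JamesTree.integrable_comp_branch μ hx α.length fun β => if β = α then (1 : 𝕜) else 0)
      fun E hE _ => ?_
    rw [← hG2 E hE α, hGg E hE,
      ← ContinuousLinearMap.integral_comp_comm _ hg.integrableOn]
  -- The density at `ω` takes the value `1` along a whole branch, so it is not in the predual.
  obtain ⟨ω, hω⟩ := hae.exists
  have h0 : Tendsto (fun n => JamesTree.predualEval 𝕜 q hq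
      (JamesTree.unitVector 𝕜 q hq (JamesTree.branch ω.down n)) (g ω)) cofinite (𝓝 0) :=
    (JamesTree.tendsto_unitVector_of_mem_predual 𝕜 q hq (g ω).2).comp
    (JamesTree.branch_injective ω.down).tendsto_cofinite
  have h1 : ∀ n, JamesTree.predualEval 𝕜 q hq
      (JamesTree.unitVector 𝕜 q hq (JamesTree.branch ω.down n)) (g ω) = 1 := fun n => by
    rw [hω, JamesTree.length_branch, if_pos rfl]
  simp only [h1] at h0
  exact one_ne_zero (tendsto_nhds_unique (f := fun _ : ℕ => (1 : 𝕜)) tendsto_const_nhds h0)
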